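/- Let $\mathbb{N}=\{1,2,\dots\}$, write $w=\sigma+it$ with $\sigma>0$ fixed and $t\in\mathbb{R}$, and let powers of $w$ be principal. For $z\in\mathbb{C}$ and $\alpha>0$ put $$G(z)=\int_{-\infty}^{\infty}w^{2z}e^{w^2}\,dt\quad(\sigma>0),$$ $$R(z,\alpha)=\int_{-\infty}^{\infty}w^{2z}\frac{e^{\alpha w^2}}{1-e^{w^2}}\,dt\quad(0<\sigma<\sqrt{\pi}),\qquad D(z,\alpha)=\int_{-\infty}^{\infty}w^{2z}\frac{e^{\alpha w^2}}{1+e^{w^2}}\,dt\quad(0<\sigma<\sqrt{\pi/2}),$$ and $R(z)=R(z,1)$, $D(z)=D(z,1)$. For $a>0$ let $\zeta(s,a)$ and $\eta(s,a)$ be the analytic continuations (to $\mathbb{C}\setminus\{1\}$ and to $\mathbb{C}$, respectively) of $\sum_{n\ge0}(n+a)^{-s}$ and $\sum_{n\ge0}(-1)^n(n+a)^{-s}$, $\operatorname{Re}s>1$. Then for every $a>0$ and every $s\in\mathbb{C}\setminus\mathbb{N}$ the integrals $G(s-\tfrac12)$, $R(s-\tfrac12,a)$ and $D(s-\tfrac12,a)$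 converge absolutely, $G(s-\tfrac12)\neq0$, and $$\zeta(s,a)=\frac{R(s-\tfrac12,a)}{G(s-\tfrac12)},\qquad \eta(s,a)=\frac{D(s-\tfrac12,a)}{G(s-\tfrac12)},$$ the first identity for every $\sigma\in(0,\sqrt{\pi})$ in $R$, the second for every $\sigma\in(0,\sqrt{\pi/2})$ in $D$, and both for every $\sigma>0$ in $G$ (not necessarily the same $\sigma$). As a consequence, the Riemann hypothesis is equivalent to the statement that all zeros of $R(z)$ in the strip $|\operatorname{Re}z|<\tfrac12$ lie on the line $\operatorname{Re}z=0$ (for any $\sigma\in(0,\sqrt\pi)$), and likewise with $R(z)$ replaced by $D(z)$ (for any $\sigma\in(0,\sqrt{\pi/2})$). -/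

import Mathlib

open Complex MeasureTheory

namespace ParabolicZeta

noncomputable section

/-- The point `w = σ + i t` of the vertical line with real part `σ`. -/
def line (σ t : ℝ) : ℂ := (σ : ℂ) + I * (t : ℂ)

/-- The integrand `w ^ (2 z) e ^ (w²)`, `w = σ + i t`; the power is the principal one. -/
def integrandG (σ : ℝ) (z : ℂ) (t : ℝ) : ℂ :=
  line σ t ^ (2 * z) * exp (line σ t ^ 2)

/-- The integrand `w ^ (2 z) e ^ (α w²) / (1 - e ^ (w²))`, `w = σ + i t`. -/
def integrandR (σ : ℝ) (z : ℂ) (α : ℝ) (t : ℝ) : ℂ :=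
  line σ t ^ (2 * z) * (exp ((α : ℂ) * line σ t ^ 2) / (1 - exp (line σ t ^ 2)))

/-- The integrand `w ^ (2 z) e ^ (α w²) / (1 + e ^ (w²))`, `w = σ + i t`. -/
def integrandD (σ : ℝ) (z : ℂ) (α : ℝ) (t : ℝ) : ℂ :=
  line σ t ^ (2 * z) * (exp ((α : ℂ) * line σ t ^ 2) / (1 + exp (line σ t ^ 2)))

/-- `G(z)`, computed on the line `Re w = σ`. -/
def G (σ : ℝ) (z : ℂ) : ℂ := ∫ t : ℝ, integrandG σ z t

/-- `R(z, α)`, computed on the line `Re w = σ`. -/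
def R (σ : ℝ) (z : ℂ) (α : ℝ) : ℂ := ∫ t : ℝ, integrandR σ z α t

/-- `D(z, α)`, computed on the line `Re w = σ`. -/
def D (σ : ℝ) (z : ℂ) (α : ℝ) : ℂ := ∫ t : ℝ, integrandD σ z α t

/-- The Hurwitz zeta function `ζ(s, a)` for every real `a > 0`: the analytic continuation of
`∑ n ≥ 0, (n + a) ^ (-s)`. Mathlib's function depends on `a` modulo `1` only and is this one for
`0 < a ≤ 1`; for `a > 1` the terms `(a - 1) ^ (-s)`, `(a - 2) ^ (-s)`, … with positive base have
to be removed. See `hasSum_zeta` and `differentiableAt_zeta`. -/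
def zeta (s : ℂ) (a : ℝ) : ℂ :=
  HurwitzZeta.hurwitzZeta (a : UnitAddCircle) s -
    ∑ j ∈ Finset.range (⌈a⌉₊ - 1), 1 / ((a - 1 - j : ℝ) : ℂ) ^ s

/-- The alternating zeta function `η(s, a)` for every real `a > 0`: the analytic continuation of
`∑ n ≥ 0, (-1) ^ n (n + a) ^ (-s)`, obtained by splitting the series into even and odd `n`.
See `hasSum_eta` and `differentiable_eta`. -/
def eta (s : ℂ) (a : ℝ) : ℂ :=
  (zeta s (a / 2) - zeta s ((a + 1) / 2)) / 2 ^ s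

/-- `ζ(s, a)` is given by its series for `Re s > 1`. -/
theorem hasSum_zeta {a : ℝ} (ha : 0 < a) {s : ℂ} (hs : 1 < s.re) :
    HasSum (fun n : ℕ => 1 / ((n + a : ℝ) : ℂ) ^ s) (zeta s a) := by
  obtain ⟨k, hk⟩ : ∃ k : ℕ, ⌈a⌉₊ = k + 1 :=
    Nat.exists_eq_succ_of_ne_zero (Nat.ceil_pos.mpr ha).ne'
  have h1 : a ≤ k + 1 := by
    have := Nat.le_ceil a
    rw [hk] at this
    exact_mod_cast this
  have h2 : (k : ℝ) < a := Nat.lt_ceil.mp (by omega)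
  have hmem : a - k ∈ Set.Icc (0 : ℝ) 1 := ⟨by linarith, by linarith⟩
  have hc : ((a - k : ℝ) : UnitAddCircle) = (a : UnitAddCircle) := by
    rw [AddCircle.coe_sub, sub_eq_self, AddCircle.coe_eq_zero_iff]
    exact ⟨k, by simp⟩
  have h := HurwitzZeta.hasSum_hurwitzZeta_of_one_lt_re hmem hs
  rw [hc, ← hasSum_nat_add_iff' k] at h
  have e : zeta s a = HurwitzZeta.hurwitzZeta (a : UnitAddCircle) s -
      ∑ i ∈ Finset.range k, 1 / ((i : ℂ) + ((a - k : ℝ) : ℂ)) ^ s := by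
    rw [zeta, hk, Nat.add_sub_cancel, ← Finset.sum_range_reflect]
    congr 1
    refine Finset.sum_congr rfl fun j hj => ?_
    have hj' := Finset.mem_range.mp hj
    have : ((k - 1 - j : ℕ) : ℂ) = (k : ℂ) - 1 - j := by
      rw [Nat.cast_sub (by omega), Nat.cast_sub (by omega)]
      simp
    push_cast
    rw [this]
    congr 2
    ring
  rw [e]
  refine Eq.subst (motive := fun f => HasSum f _) (funext fun n => ?_) h
  push_cast
  congr 2
  ring

/-- `ζ(s, a)` is holomorphic away from `s = 1`. -/
theorem differentiableAt_zeta (a : ℝ) {s : ℂ} (hs : s ≠ 1) :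
    DifferentiableAt ℂ (fun s => zeta s a) s := by
  refine (HurwitzZeta.differentiableAt_hurwitzZeta _ hs).sub ?_
  refine DifferentiableAt.fun_sum fun j hj => ?_
  have hj' := Finset.mem_range.mp hj
  have h2 : ((j + 1 : ℕ) : ℝ) < a := Nat.lt_ceil.mp (by omega)
  push_cast at h2
  have h3 : ((a - 1 - j : ℝ) : ℂ) ≠ 0 := by
    rw [Complex.ofReal_ne_zero]
    linarith
  refine (differentiableAt_const _).div (differentiableAt_id.const_cpow (Or.inl h3)) ?_
  exact fun h0 => h3 ((Complex.cpow_eq_zero_iff _ _).mp h0).1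

/-- `η(s, a)` is given by its series for `Re s > 1`. -/
theorem hasSum_eta {a : ℝ} (ha : 0 < a) {s : ℂ} (hs : 1 < s.re) :
    HasSum (fun n : ℕ => (-1) ^ n / ((n + a : ℝ) : ℂ) ^ s) (eta s a) := by
  have key : ∀ x : ℝ, 0 < x → ((2 * x : ℝ) : ℂ) ^ s = 2 ^ s * (x : ℂ) ^ s := fun x hx => by
    have := Complex.mul_cpow_ofReal_nonneg (zero_le_two) hx.le s
    push_cast at this ⊢
    exact this
  have h0 := (hasSum_zeta (half_pos ha) hs).div_const ((2 : ℂ) ^ s)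
  have h1 := ((hasSum_zeta (a := (a + 1) / 2) (by linarith) hs).div_const ((2 : ℂ) ^ s)).neg
  have e : eta s a = zeta s (a / 2) / 2 ^ s + -(zeta s ((a + 1) / 2) / 2 ^ s) := by
    rw [eta, sub_div, sub_eq_add_neg]
  rw [e]
  refine HasSum.even_add_odd ?_ ?_
  · refine Eq.subst (motive := fun f => HasSum f _) (funext fun n => ?_) h0
    have : ((2 * n : ℕ) : ℝ) + a = 2 * (n + a / 2) := by push_cast; ring
    rw [this, key _ (by positivity), pow_mul]
    simp [div_eq_mul_inv]
  · refine Eq.subst (motive := fun f => HasSum f _) (funext fun n => ?_) h1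
    have : ((2 * n + 1 : ℕ) : ℝ) + a = 2 * (n + (a + 1) / 2) := by push_cast; ring
    rw [this, key _ (by positivity), pow_succ, pow_mul]
    simp [div_eq_mul_inv]

/-- `η(s, a)` is entire. -/
theorem differentiable_eta (a : ℝ) : Differentiable ℂ (fun s => eta s a) := by
  have hsum : ∀ b : ℝ, Differentiable ℂ
      (fun s : ℂ => ∑ j ∈ Finset.range (⌈b⌉₊ - 1), 1 / ((b - 1 - j : ℝ) : ℂ) ^ s) := by
    intro b
    refine Differentiable.fun_sum fun j hj => ?_
    have hj' := Finset.mem_range.mp hj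
    have h2 : ((j + 1 : ℕ) : ℝ) < b := Nat.lt_ceil.mp (by omega)
    push_cast at h2
    have h3 : ((b - 1 - j : ℝ) : ℂ) ≠ 0 := by
      rw [Complex.ofReal_ne_zero]
      linarith
    refine (differentiable_const _).div (differentiable_id.const_cpow (Or.inl h3)) fun s => ?_
    exact fun h0 => h3 ((Complex.cpow_eq_zero_iff _ _).mp h0).1
  have e : (fun s => eta s a) = fun s : ℂ =>
      ((HurwitzZeta.hurwitzZeta ((a / 2 : ℝ) : UnitAddCircle) s -
        HurwitzZeta.hurwitzZeta (((a + 1) / 2 : ℝ) : UnitAddCircle) s) -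
      ((∑ j ∈ Finset.range (⌈a / 2⌉₊ - 1), 1 / ((a / 2 - 1 - j : ℝ) : ℂ) ^ s) -
        ∑ j ∈ Finset.range (⌈(a + 1) / 2⌉₊ - 1), 1 / (((a + 1) / 2 - 1 - j : ℝ) : ℂ) ^ s)) /
      2 ^ s := by
    funext s
    rw [eta, zeta, zeta]
    congr 1
    ring
  rw [e]
  refine Differentiable.div ?_ (differentiable_id.const_cpow (Or.inl two_ne_zero)) fun s => ?_
  · exact (HurwitzZeta.differentiable_hurwitzZeta_sub_hurwitzZeta _ _).sub
      ((hsum _).sub (hsum _))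
  · simp [Complex.cpow_eq_zero_iff]

end

end ParabolicZeta

/-! All three integrals have the form of `w ^ (2s - 1)` against `kernel ε α`, with `ε = 0, 1, -1`
for `G`, `R`, `D`. If `Re s > 3/2`, the power outweighs the double pole that the kernel may have at
the origin, and Cauchy's theorem moves the line to the imaginary axis
(`integral_cpow_mul_kernel_eq`). The bounds on `σ` keep all other poles to the right of the line. On
the axis `w² = -t²`; the two half-axes carry the factors `(±i) ^ (2s - 1)`, which add up to `2 sin
πs`, and what is left is half a Mellin transform, computed by expanding a geometric series. The
integral is therefore `sin(πs) Γ(s) ∑ εⁿ (n + α)⁻ˢ`.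

For `ε = 0` the sum is `1`, so dividing by `G` leaves the zeta function. Gaussian decay makes the
integrals on the original line entire in `s`, and the identity theorem extends the result to `s ≠ 1`
(`integral_eq_G_mul`). By reflection `G = π / Γ(1 - s)`, which vanishes only at positive integers.

In the critical strip the zeros of `R` are thus those of `ζ`; so are those of `D`, because `η(s, 1)
= (1 - 2 ^ (1 - s)) ζ(s)` and the first factor vanishes only on `Re s = 1`. -/

namespace ParabolicZeta

open Filter Topology Set

/-! ### Vertical lines and Cauchy's theorem -/

lemma line_re (σ t : ℝ) : (line σ t).re = σ := by simp [line]

lemma line_im (σ t : ℝ) : (line σ t).im = t := by simp [line]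

lemma continuous_line (σ : ℝ) : Continuous (line σ) := by unfold line; fun_prop

lemma line_mem_slitPlane {σ : ℝ} (hσ : 0 < σ) (t : ℝ) : line σ t ∈ slitPlane :=
  Or.inl (by rwa [line_re])

lemma line_ne_zero {σ : ℝ} (hσ : 0 < σ) (t : ℝ) : line σ t ≠ 0 :=
  slitPlane_ne_zero (line_mem_slitPlane hσ t)

/-- A linear exponential is absorbed by half of a Gaussian. -/
lemma mul_abs_sub_sq_le {δ : ℝ} (hδ : 0 < δ) (M t : ℝ) :
    M * |t| - δ * t ^ 2 ≤ M ^ 2 / (2 * δ) - δ / 2 * t ^ 2 := by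
  have h : M ^ 2 / (2 * δ) - δ / 2 * t ^ 2 - (M * |t| - δ * t ^ 2) =
      (M - δ * |t|) ^ 2 / (2 * δ) := by
    rw [← sq_abs t]; field_simp; ring
  have : 0 ≤ (M - δ * |t|) ^ 2 / (2 * δ) := by positivity
  linarith

lemma integrable_of_gaussian_bound {f : ℝ → ℂ} {A δ : ℝ} (hδ : 0 < δ) (hf : Continuous f)
    (hb : ∀ t, ‖f t‖ ≤ A * Real.exp (-δ * t ^ 2)) : Integrable f :=
  ((integrable_exp_neg_mul_sq hδ).const_mul A).mono' hf.aestronglyMeasurable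
    (Eventually.of_forall hb)

/-- Cauchy's theorem for a vertical strip and a function with Gaussian decay. -/
theorem integral_line_eq_integral_line_zero {f : ℂ → ℂ} {σ δ A : ℝ} (hσ : 0 ≤ σ) (hδ : 0 < δ)
    (hc : ContinuousOn f {w | 0 ≤ w.re ∧ w.re ≤ σ})
    (hd : ∀ w : ℂ, 0 < w.re → w.re < σ → DifferentiableAt ℂ f w)
    (hb : ∀ w : ℂ, 0 ≤ w.re → w.re ≤ σ → ‖f w‖ ≤ A * Real.exp (-δ * w.im ^ 2)) :
    Integrable (fun t : ℝ => f (line 0 t)) ∧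
      ∫ t : ℝ, f (line σ t) = ∫ t : ℝ, f (line 0 t) := by
  have hint : ∀ x : ℝ, 0 ≤ x → x ≤ σ → Integrable fun t : ℝ => f (line x t) := by
    intro x hx hx'
    refine integrable_of_gaussian_bound (A := A) hδ ?_ fun t => ?_
    · refine hc.comp_continuous (continuous_line x) fun t => ?_
      simp only [mem_ofPred_eq, line_re]
      exact ⟨hx, hx'⟩
    · have := hb (line x t) (by rwa [line_re]) (by rwa [line_re])
      rwa [line_im] at this
  have hrect : ∀ T : ℝ, (∫ x : ℝ in (0 : ℝ)..σ, f (x + (-T : ℝ) * I)) -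
      (∫ x : ℝ in (0 : ℝ)..σ, f (x + T * I)) =
      I * (∫ y : ℝ in (-T)..T, f (line 0 y)) - I * (∫ y : ℝ in (-T)..T, f (line σ y)) := by
    intro T
    have h := integral_boundary_rect_eq_zero_of_continuousOn_of_differentiableOn f
      ⟨0, -T⟩ ⟨σ, T⟩ ?_ ?_
    · simp only [smul_eq_mul] at h
      have e : ∀ x y : ℝ, (x : ℂ) + y * I = line x y := fun x y => by rw [line, mul_comm I]
      simp only [e] at h ⊢
      linear_combination h
    · refine hc.mono fun w hw => ?_
      have := hw.1
      simp only [mem_preimage, uIcc_of_le hσ] at this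
      exact this
    · intro w hw
      have := hw.1
      simp only [mem_preimage, min_eq_left hσ, max_eq_right hσ] at this
      exact (hd w this.1 this.2).differentiableWithinAt
  -- The horizontal sides have fixed length `σ`, so the Gaussian bound makes them vanish as `T → ∞`.
  have hhor : ∀ T : ℝ, ‖∫ x : ℝ in (0 : ℝ)..σ, f (x + T * I)‖ ≤
      A * Real.exp (-δ * T ^ 2) * σ := by
    intro T
    have h := intervalIntegral.norm_integral_le_of_norm_le_const (a := 0) (b := σ)
      (f := fun x : ℝ => f (x + T * I)) (C := A * Real.exp (-δ * T ^ 2)) ?_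
    · rwa [sub_zero, abs_of_nonneg hσ] at h
    · intro x hx
      rw [uIoc_of_le hσ] at hx
      simpa using hb (x + T * I) (by simpa using hx.1.le) (by simpa using hx.2)
  have hgauss : Tendsto (fun T : ℝ => A * Real.exp (-δ * T ^ 2) * σ) atTop (𝓝 0) := by
    have h1 : Tendsto (fun T : ℝ => -δ * T ^ 2) atTop atBot :=
      (tendsto_pow_atTop two_ne_zero).const_mul_atTop_of_neg (by linarith)
    simpa using ((Real.tendsto_exp_atBot.comp h1).const_mul A).mul_const σ
  have hup : Tendsto (fun T : ℝ => ∫ x : ℝ in (0 : ℝ)..σ, f (x + T * I)) atTop (𝓝 0) :=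
    squeeze_zero_norm hhor hgauss
  have hdown : Tendsto (fun T : ℝ => ∫ x : ℝ in (0 : ℝ)..σ, f (x + (-T : ℝ) * I))
      atTop (𝓝 0) :=
    squeeze_zero_norm (fun T => by simpa using hhor (-T)) hgauss
  have hside : ∀ x : ℝ, 0 ≤ x → x ≤ σ → Tendsto
      (fun T : ℝ => ∫ y : ℝ in (-T)..T, f (line x y)) atTop (𝓝 (∫ y : ℝ, f (line x y))) :=
    fun x hx hx' => intervalIntegral_tendsto_integral (hint x hx hx')
      tendsto_neg_atTop_atBot tendsto_id
  have hlim := (((hside 0 le_rfl hσ).const_mul I).sub ((hside σ hσ le_rfl).const_mul I))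
  have hlim' := hdown.sub hup
  simp only [hrect, sub_zero] at hlim'
  have := tendsto_nhds_unique hlim hlim'
  rw [← mul_sub, mul_eq_zero, sub_eq_zero] at this
  exact ⟨hint 0 le_rfl hσ, (this.resolve_left I_ne_zero).symm⟩

/-! ### Holomorphy in the exponent -/

/-- Linear growth is crude but enough, since a Gaussian absorbs `exp (M |t|)`. The term `σ⁻¹` bounds
`-log ‖w‖`, because `‖w‖ ≥ σ`; `π` bounds the argument. -/
lemma norm_log_line_le {σ : ℝ} (hσ : 0 < σ) (t : ℝ) :
    ‖log (line σ t)‖ ≤ |t| + (σ + σ⁻¹ + Real.pi) := by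
  have h1 : ‖line σ t‖ ≤ σ + |t| := by
    have := norm_le_abs_re_add_abs_im (line σ t)
    rwa [line_re, line_im, abs_of_pos hσ] at this
  have h2 : σ ≤ ‖line σ t‖ := by
    have := (le_abs_self _).trans (abs_re_le_norm (line σ t))
    rwa [line_re] at this
  have h3 : 0 < ‖line σ t‖ := hσ.trans_le h2
  have h4 : |Real.log ‖line σ t‖| ≤ σ + |t| + σ⁻¹ := by
    rw [abs_le]
    constructor
    · have := Real.log_le_self (inv_pos.mpr h3).le
      rw [Real.log_inv] at this
      have h5 : ‖line σ t‖⁻¹ ≤ σ⁻¹ := inv_anti₀ hσ h2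
      have := abs_nonneg t
      linarith
    · have := Real.log_le_self h3.le
      have := inv_pos.mpr hσ
      linarith
  have h5 := norm_le_abs_re_add_abs_im (log (line σ t))
  rw [log_re, log_im] at h5
  have := abs_arg_le_pi (line σ t)
  linarith

lemma norm_cpow_le_exp {w : ℂ} (hw : w ≠ 0) (c : ℂ) : ‖w ^ c‖ ≤ Real.exp (‖c‖ * ‖log w‖) := by
  rw [cpow_def_of_ne_zero hw, norm_exp]
  refine Real.exp_le_exp.mpr ((re_le_norm _).trans ?_)
  rw [norm_mul, mul_comm]

section Parameter

variable {σ A δ : ℝ} {g : ℝ → ℂ}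

lemma exp_mul_log_line_mul_gaussian_le (hσ : 0 < σ) (hδ : 0 < δ) (hA : 0 ≤ A) {M : ℝ}
    (hM : 0 ≤ M) (t : ℝ) :
    Real.exp (M * ‖log (line σ t)‖) * (A * Real.exp (-δ * t ^ 2)) ≤
      A * Real.exp (M * (σ + σ⁻¹ + Real.pi) + M ^ 2 / (2 * δ)) *
        Real.exp (-(δ / 2) * t ^ 2) := by
  have h1 := mul_le_mul_of_nonneg_left (norm_log_line_le hσ t) hM
  have h2 := mul_abs_sub_sq_le hδ M t
  calc _ = A * Real.exp (M * ‖log (line σ t)‖ + -δ * t ^ 2) := by rw [Real.exp_add]; ring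
    _ ≤ A * Real.exp (M * (σ + σ⁻¹ + Real.pi) + M ^ 2 / (2 * δ) + -(δ / 2) * t ^ 2) := by
        refine mul_le_mul_of_nonneg_left (Real.exp_le_exp.mpr ?_) hA
        linarith
    _ = _ := by rw [Real.exp_add]; ring

lemma continuous_line_cpow_mul (hσ : 0 < σ) (hg : Continuous g) (c : ℂ) :
    Continuous fun t => line σ t ^ c * g t :=
  ((continuous_line σ).cpow continuous_const fun t => line_mem_slitPlane hσ t).mul hg

lemma integrable_line_cpow_mul (hσ : 0 < σ) (hδ : 0 < δ) (hg : Continuous g)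
    (hb : ∀ t, ‖g t‖ ≤ A * Real.exp (-δ * t ^ 2)) (c : ℂ) :
    Integrable fun t => line σ t ^ c * g t := by
  have hA : 0 ≤ A := by simpa using (norm_nonneg _).trans (hb 0)
  refine integrable_of_gaussian_bound (half_pos hδ) (continuous_line_cpow_mul hσ hg c) fun t =>
    le_trans ?_ (exp_mul_log_line_mul_gaussian_le hσ hδ hA (norm_nonneg c) t)
  rw [norm_mul]
  exact mul_le_mul (norm_cpow_le_exp (line_ne_zero hσ t) c) (hb t) (norm_nonneg _)
    (Real.exp_pos _).le

/-- An integral of a power of `w` against a function with Gaussian decay on a vertical line is an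
entire function of the exponent. -/
theorem differentiable_integral_line_cpow_mul (hσ : 0 < σ) (hδ : 0 < δ) (hg : Continuous g)
    (hb : ∀ t, ‖g t‖ ≤ A * Real.exp (-δ * t ^ 2)) :
    Differentiable ℂ fun c : ℂ => ∫ t, line σ t ^ c * g t := by
  intro c₀
  have hA : 0 ≤ A := by simpa using (norm_nonneg _).trans (hb 0)
  -- One unit covers the ball of radius `1` around `c₀`, the other the factor `log w ≤ exp ‖log w‖`
  -- (in norm) produced by differentiation.
  set M : ℝ := ‖c₀‖ + 2 with hM
  have hM0 : 0 ≤ M := by positivity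
  have hlog : Continuous fun t => log (line σ t) :=
    (continuous_line σ).clog fun t => line_mem_slitPlane hσ t
  refine (hasDerivAt_integral_of_dominated_loc_of_deriv_le (Metric.ball_mem_nhds c₀ one_pos)
    (F := fun c t => line σ t ^ c * g t)
    (F' := fun c t => line σ t ^ c * log (line σ t) * g t)
    (bound := fun t => A * Real.exp (M * (σ + σ⁻¹ + Real.pi) + M ^ 2 / (2 * δ)) *
        Real.exp (-(δ / 2) * t ^ 2))
    (Eventually.of_forall fun c => (continuous_line_cpow_mul hσ hg c).aestronglyMeasurable)
    (integrable_line_cpow_mul hσ hδ hg hb c₀) ?_ ?_ ?_ ?_).2.differentiableAt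
  · refine Continuous.aestronglyMeasurable ?_
    simp only [mul_assoc]
    exact continuous_line_cpow_mul hσ (hlog.mul hg) c₀
  · refine Eventually.of_forall fun t c hc => le_trans ?_
      (exp_mul_log_line_mul_gaussian_le hσ hδ hA hM0 t)
    have hc' : ‖c‖ + 1 ≤ M := by
      have h1 := norm_le_norm_add_norm_sub' c c₀
      rw [Metric.mem_ball, dist_eq_norm] at hc
      linarith
    rw [norm_mul, norm_mul]
    refine mul_le_mul ?_ (hb t) (norm_nonneg _) (Real.exp_pos _).le
    calc ‖line σ t ^ c‖ * ‖log (line σ t)‖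
        ≤ Real.exp (‖c‖ * ‖log (line σ t)‖) * Real.exp ‖log (line σ t)‖ := by
          gcongr
          · exact norm_cpow_le_exp (line_ne_zero hσ t) c
          · have := Real.add_one_le_exp ‖log (line σ t)‖
            linarith
      _ = Real.exp ((‖c‖ + 1) * ‖log (line σ t)‖) := by rw [← Real.exp_add]; ring_nf
      _ ≤ _ := by gcongr
  · exact (integrable_exp_neg_mul_sq (half_pos hδ)).const_mul _
  · refine Eventually.of_forall fun t c _ => ?_
    exact ((hasDerivAt_id c).const_cpow (Or.inl (line_ne_zero hσ t))).mul_const (g t) |>.congr_deriv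
      (by simp)

end Parameter

/-! ### Zeros of the denominator -/

noncomputable section

/-- The factor `e ^ (α w²) / (1 - ε e ^ (w²))` common to the three integrands. -/
def kernel (ε : ℂ) (α : ℝ) (w : ℂ) : ℂ := exp (α * w ^ 2) / (1 - ε * exp (w ^ 2))

end

lemma sq_re (w : ℂ) : (w ^ 2).re = w.re ^ 2 - w.im ^ 2 := by simp [pow_two]

lemma sq_im (w : ℂ) : (w ^ 2).im = 2 * (w.re * w.im) := by simp [pow_two]; ring

lemma abs_re_mul_im_of_sq_re_eq_zero {w : ℂ} (h : (w ^ 2).re = 0) :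
    |w.re * w.im| = w.re ^ 2 := by
  rw [sq_re, sub_eq_zero] at h
  rw [abs_mul, ← (sq_eq_sq_iff_abs_eq_abs _ _).mp h, abs_mul_abs_self, pow_two]

/-- The solutions satisfy `w² = 2πin`, so they lie on the diagonals `|Re w| = |Im w|` and `(Re w)² =
π|n|`. -/
lemma eq_zero_of_exp_sq_eq_one {w : ℂ} (hw : w.re ^ 2 < Real.pi) (h : exp (w ^ 2) = 1) :
    w = 0 := by
  obtain ⟨n, hn⟩ := exp_eq_one_iff.mp h
  have hre : (w ^ 2).re = 0 := by rw [hn]; simp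
  have him : w.re * w.im = n * Real.pi := by
    have := sq_im w
    rw [hn] at this
    simp at this
    linarith
  have habs := abs_re_mul_im_of_sq_re_eq_zero hre
  rw [him, abs_mul, abs_of_pos Real.pi_pos] at habs
  have hlt : |(n : ℝ)| < 1 := by
    by_contra hge
    have := le_mul_of_one_le_left Real.pi_pos.le (not_lt.mp hge)
    linarith
  have hn0 : n = 0 := by
    rw [← Int.abs_lt_one_iff]
    exact_mod_cast hlt
  simpa [hn0] using hn

/-- Here `w² = (2n + 1)πi`, hence `(Re w)² = |2n + 1| π/2 ≥ π/2`. -/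
lemma exp_sq_ne_neg_one {w : ℂ} (hw : w.re ^ 2 < Real.pi / 2) : exp (w ^ 2) ≠ -1 := by
  intro h
  rw [← exp_pi_mul_I, exp_eq_exp_iff_exists_int] at h
  obtain ⟨n, hn⟩ := h
  have hre : (w ^ 2).re = 0 := by rw [hn]; simp
  have him : 2 * (w.re * w.im) = (2 * n + 1 : ℤ) * Real.pi := by
    have := sq_im w
    rw [hn] at this
    simp at this
    push_cast
    linarith
  have habs := abs_re_mul_im_of_sq_re_eq_zero hre
  have h2 : 2 * w.re ^ 2 = |((2 * n + 1 : ℤ) : ℝ)| * Real.pi := by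
    have := congrArg abs him
    rwa [abs_mul, abs_two, habs, abs_mul, abs_of_pos Real.pi_pos] at this
  have h1 : (1 : ℝ) ≤ |((2 * n + 1 : ℤ) : ℝ)| := by
    rw [← Int.cast_abs]
    exact_mod_cast Int.one_le_abs (by omega)
  have := le_mul_of_one_le_left Real.pi_pos.le h1
  linarith

/-- `1 - ε e ^ (w²)` vanishes at most to second order at the origin, and nowhere else on the closed
strip `0 ≤ Re w ≤ σ`. -/
def DenominatorBound (ε : ℂ) (σ c : ℝ) : Prop :=
  0 < c ∧ ∀ w : ℂ, 0 ≤ w.re → w.re ≤ σ → c * ‖w‖ ^ 2 ≤ ‖1 - ε * exp (w ^ 2)‖ * (1 + ‖w‖ ^ 2)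

/-- `φ` stands for the denominator with any zero at the origin divided out. Compactness bounds it
below for `|Im w| ≤ σ + 1`; beyond that `Re w² ≤ -1`, so the exponential has norm at most `1/2`. -/
lemma exists_denominatorBound {ε : ℂ} {σ : ℝ} {φ : ℂ → ℂ} (hσ : 0 ≤ σ) (hε : ‖ε‖ ≤ 1)
    (hφ : Continuous φ) (hφ0 : ∀ w : ℂ, 0 ≤ w.re → w.re ≤ σ → φ w ≠ 0)
    (hle : ∀ w : ℂ, ‖w‖ ^ 2 * ‖φ w‖ ≤ ‖1 - ε * exp (w ^ 2)‖ * (1 + ‖w‖ ^ 2)) :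
    ∃ c, DenominatorBound ε σ c := by
  obtain ⟨c, hc, hcK⟩ : ∃ c : ℝ, 0 < c ∧
      ∀ w ∈ Icc 0 σ ×ℂ Icc (-(σ + 1)) (σ + 1), c ≤ ‖φ w‖ := by
    refine (isCompact_Icc.reProdIm isCompact_Icc).exists_forall_le' hφ.norm.continuousOn
      (a := 0) fun w hw => ?_
    have := hw.1
    exact norm_pos_iff.mpr (hφ0 w this.1 this.2)
  refine ⟨min c (1 / 2), lt_min hc one_half_pos, fun w hw hw' => ?_⟩
  by_cases him : |w.im| ≤ σ + 1
  · calc min c (1 / 2) * ‖w‖ ^ 2 ≤ ‖φ w‖ * ‖w‖ ^ 2 := by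
          gcongr
          exact (min_le_left _ _).trans (hcK w ⟨⟨hw, hw'⟩, abs_le.mp him⟩)
      _ ≤ _ := by rw [mul_comm]; exact hle w
  · have h1 : (w ^ 2).re ≤ -1 := by
      rw [sq_re, ← sq_abs w.im]
      nlinarith
    have h2 : ‖ε * exp (w ^ 2)‖ ≤ 1 / 2 := by
      rw [norm_mul, norm_exp]
      have h3 : Real.exp (w ^ 2).re ≤ 1 / 2 := by
        refine (Real.exp_le_exp.mpr h1).trans ?_
        rw [Real.exp_neg, one_div]
        exact inv_anti₀ two_pos (by linarith [Real.add_one_le_exp (1 : ℝ)])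
      nlinarith [norm_nonneg ε, Real.exp_pos (w ^ 2).re]
    have h3 : 1 / 2 ≤ ‖1 - ε * exp (w ^ 2)‖ := by
      have := norm_sub_norm_le (1 : ℂ) (ε * exp (w ^ 2))
      rw [norm_one] at this
      linarith
    have h4 := min_le_right c (1 / 2)
    nlinarith [sq_nonneg ‖w‖]

lemma sq_lt_of_lt_sqrt {x σ y : ℝ} (hx : 0 ≤ x) (hxσ : x ≤ σ) (h : σ < √y) : x ^ 2 < y :=
  (Real.lt_sqrt hx).mp (hxσ.trans_lt h)

/-- The double zero is removed by taking `φ` to be `(eᵘ - 1)/u` at `u = w²`, which `dslope` extends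
by the value `1` at `u = 0`. -/
theorem exists_denominatorBound_one {σ : ℝ} (hσ : 0 ≤ σ) (h : σ < √Real.pi) :
    ∃ c, DenominatorBound 1 σ c := by
  have hmul : ∀ w : ℂ, w ^ 2 * dslope exp 0 (w ^ 2) = exp (w ^ 2) - 1 := fun w => by
    simpa using sub_smul_dslope exp 0 (w ^ 2)
  refine exists_denominatorBound (φ := fun w => dslope exp 0 (w ^ 2)) hσ (by simp) ?_ ?_ ?_
  · have : Continuous (dslope exp (0 : ℂ)) := by
      rw [continuous_iff_continuousAt]
      intro u
      by_cases hu : u = 0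
      · rw [hu, continuousAt_dslope_same]
        exact differentiable_exp 0
      · rw [continuousAt_dslope_of_ne hu]
        exact continuous_exp.continuousAt
    exact this.comp (continuous_pow 2)
  · intro w hw hw' h0
    have h1 := hmul w
    rw [h0, mul_zero, eq_comm, sub_eq_zero] at h1
    have := eq_zero_of_exp_sq_eq_one (sq_lt_of_lt_sqrt hw hw' h) h1
    simp [this, dslope_same] at h0
  · intro w
    rw [one_mul, ← norm_pow, ← norm_mul, hmul, norm_sub_rev]
    exact le_mul_of_one_le_right (norm_nonneg _) (le_add_of_nonneg_right (norm_nonneg _))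

lemma exists_denominatorBound_of_ne_zero {ε : ℂ} {σ : ℝ} (hσ : 0 ≤ σ) (hε : ‖ε‖ ≤ 1)
    (h0 : ∀ w : ℂ, 0 ≤ w.re → w.re ≤ σ → 1 - ε * exp (w ^ 2) ≠ 0) :
    ∃ c, DenominatorBound ε σ c :=
  exists_denominatorBound (φ := fun w => 1 - ε * exp (w ^ 2)) hσ hε (by fun_prop) h0 fun w => by
    nlinarith [norm_nonneg (1 - ε * exp (w ^ 2))]

theorem exists_denominatorBound_neg_one {σ : ℝ} (hσ : 0 ≤ σ) (h : σ < √(Real.pi / 2)) :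
    ∃ c, DenominatorBound (-1) σ c :=
  exists_denominatorBound_of_ne_zero hσ (by simp) fun w hw hw' h0 =>
    exp_sq_ne_neg_one (sq_lt_of_lt_sqrt hw hw' h) (by linear_combination h0)

theorem exists_denominatorBound_zero {σ : ℝ} (hσ : 0 ≤ σ) : ∃ c, DenominatorBound 0 σ c :=
  exists_denominatorBound_of_ne_zero hσ (by simp) fun w _ _ => by simp

/-! ### Bounds for the kernel and the shift of contour -/

namespace DenominatorBound

variable {ε : ℂ} {σ c : ℝ}

lemma ne_zero (hB : DenominatorBound ε σ c) {w : ℂ} (h0 : 0 ≤ w.re) (hσ : w.re ≤ σ)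
    (hw : w ≠ 0) : 1 - ε * exp (w ^ 2) ≠ 0 := by
  intro h
  have h1 := hB.2 w h0 hσ
  rw [h, norm_zero, zero_mul] at h1
  have : 0 < c * ‖w‖ ^ 2 := mul_pos hB.1 (by positivity)
  linarith

lemma differentiableAt_kernel (hB : DenominatorBound ε σ c) (α : ℝ) {w : ℂ} (h0 : 0 ≤ w.re)
    (hσ : w.re ≤ σ) (hw : w ≠ 0) : DifferentiableAt ℂ (kernel ε α) w := by
  unfold kernel
  exact DifferentiableAt.div (by fun_prop) (by fun_prop) (hB.ne_zero h0 hσ hw)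

lemma norm_kernel_le (hB : DenominatorBound ε σ c) {α : ℝ} {w : ℂ} (h0 : 0 ≤ w.re)
    (hσ : w.re ≤ σ) (hw : w ≠ 0) :
    ‖kernel ε α w‖ ≤
      c⁻¹ * Real.exp (α * (w.re ^ 2 - w.im ^ 2)) * (1 + ‖w‖ ^ 2) * (‖w‖ ^ 2)⁻¹ := by
  have h1 := hB.2 w h0 hσ
  have h2 : 0 < ‖1 - ε * exp (w ^ 2)‖ := norm_pos_iff.mpr (hB.ne_zero h0 hσ hw)
  have h3 : 0 < ‖w‖ := norm_pos_iff.mpr hw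
  have hc := hB.1
  rw [kernel, norm_div, norm_exp, re_ofReal_mul, sq_re, div_le_iff₀ h2]
  have h4 : 1 ≤ c⁻¹ * (1 + ‖w‖ ^ 2) * (‖w‖ ^ 2)⁻¹ * ‖1 - ε * exp (w ^ 2)‖ := by
    rw [← div_eq_inv_mul, ← div_eq_mul_inv, div_div, div_mul_eq_mul_div, one_le_div (by positivity)]
    linarith
  have h5 := mul_le_mul_of_nonneg_left h4 (Real.exp_pos (α * (w.re ^ 2 - w.im ^ 2))).le
  linarith

/-- Gaussian decay of the kernel after multiplication by a power of large enough real part. -/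
lemma norm_cpow_mul_kernel_le (hB : DenominatorBound ε σ c) {α : ℝ}
    {p : ℂ} {w : ℂ} (h0 : 0 ≤ w.re) (hσ : w.re ≤ σ) (hw : w ≠ 0) :
    ‖w ^ p * kernel ε α w‖ ≤ ‖w‖ ^ (p.re - 2) *
      (c⁻¹ * Real.exp (Real.pi * |p.im|) * Real.exp (α * (w.re ^ 2 - w.im ^ 2)) *
        (1 + ‖w‖ ^ 2)) := by
  have h3 : 0 < ‖w‖ := norm_pos_iff.mpr hw
  have hc := hB.1
  have h1 : ‖w ^ p‖ ≤ ‖w‖ ^ p.re * Real.exp (Real.pi * |p.im|) := by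
    rw [norm_cpow_of_ne_zero hw, div_eq_mul_inv, ← Real.exp_neg]
    gcongr
    calc -(arg w * p.im) ≤ |arg w * p.im| := neg_le_abs _
      _ ≤ _ := by rw [abs_mul]; gcongr; exact abs_arg_le_pi w
  have h2 : ‖w‖ ^ (p.re - 2) = ‖w‖ ^ p.re * (‖w‖ ^ 2)⁻¹ := by
    rw [Real.rpow_sub h3, div_eq_mul_inv, Real.rpow_two]
  rw [norm_mul, h2]
  refine (mul_le_mul h1 (hB.norm_kernel_le h0 hσ hw) (norm_nonneg _) (by positivity)).trans
    (le_of_eq ?_)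
  ring

/-- The line stays at distance `σ` from the origin, so the double pole costs only the factor `1 +
σ⁻²`. -/
lemma exists_gaussian_bound_kernel_line (hB : DenominatorBound ε σ c) (hσ : 0 < σ) (α : ℝ) :
    ∃ A, ∀ t, ‖kernel ε α (line σ t)‖ ≤ A * Real.exp (-α * t ^ 2) := by
  refine ⟨c⁻¹ * Real.exp (α * σ ^ 2) * (1 + (σ ^ 2)⁻¹), fun t => ?_⟩
  have hw := line_ne_zero hσ t
  have h := hB.norm_kernel_le (α := α) (by rw [line_re]; exact hσ.le) (line_re σ t).le hw
  refine h.trans ?_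
  have hc := hB.1
  have hn : σ ≤ ‖line σ t‖ := by
    simpa [line_re] using (le_abs_self _).trans (abs_re_le_norm (line σ t))
  have h3 : 0 < ‖line σ t‖ := norm_pos_iff.mpr hw
  have h1 : (1 + ‖line σ t‖ ^ 2) * (‖line σ t‖ ^ 2)⁻¹ ≤ 1 + (σ ^ 2)⁻¹ := by
    rw [add_mul, mul_inv_cancel₀ (by positivity), one_mul, add_comm]
    gcongr
  rw [line_re, line_im, mul_sub, sub_eq_add_neg, Real.exp_add, ← neg_mul]
  calc _ = c⁻¹ * Real.exp (α * σ ^ 2) * Real.exp (-α * t ^ 2) *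
        ((1 + ‖line σ t‖ ^ 2) * (‖line σ t‖ ^ 2)⁻¹) := by ring
    _ ≤ c⁻¹ * Real.exp (α * σ ^ 2) * Real.exp (-α * t ^ 2) * (1 + (σ ^ 2)⁻¹) := by gcongr
    _ = _ := by ring

lemma continuous_kernel_line (hB : DenominatorBound ε σ c) (hσ : 0 < σ) (α : ℝ) :
    Continuous fun t => kernel ε α (line σ t) :=
  continuous_iff_continuousAt.mpr fun t =>
    ContinuousAt.comp (f := line σ) (hB.differentiableAt_kernel α (by rw [line_re]; exact hσ.le)
      (line_re σ t).le (line_ne_zero hσ t)).continuousAt (continuous_line σ).continuousAt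

theorem integrable_cpow_mul_kernel (hB : DenominatorBound ε σ c) (hσ : 0 < σ) {α : ℝ}
    (hα : 0 < α) (p : ℂ) : Integrable fun t => line σ t ^ p * kernel ε α (line σ t) := by
  obtain ⟨A, hA⟩ := hB.exists_gaussian_bound_kernel_line hσ α
  exact integrable_line_cpow_mul hσ hα (hB.continuous_kernel_line hσ α) hA p

theorem differentiable_integral_cpow_mul_kernel (hB : DenominatorBound ε σ c) (hσ : 0 < σ) {α : ℝ}
    (hα : 0 < α) : Differentiable ℂ fun p : ℂ => ∫ t, line σ t ^ p * kernel ε α (line σ t) := by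
  obtain ⟨A, hA⟩ := hB.exists_gaussian_bound_kernel_line hσ α
  exact differentiable_integral_line_cpow_mul hσ hα (hB.continuous_kernel_line hσ α) hA

/-- The line of integration can be moved to the imaginary axis. -/
theorem integral_cpow_mul_kernel_eq (hB : DenominatorBound ε σ c) (hσ : 0 < σ) {α : ℝ}
    (hα : 0 < α) {p : ℂ} (hp : 2 < p.re) :
    Integrable (fun t => line 0 t ^ p * kernel ε α (line 0 t)) ∧
      ∫ t, line σ t ^ p * kernel ε α (line σ t) = ∫ t, line 0 t ^ p * kernel ε α (line 0 t) := by
  have hp0 : p ≠ 0 := fun h => by simp [h] at hp; linarith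
  have hc := hB.1
  have hslit : ∀ w : ℂ, 0 ≤ w.re → w ≠ 0 → w ∈ slitPlane := by
    intro w h0 hw
    rw [mem_slitPlane_iff]
    by_contra! h
    exact hw (Complex.ext (le_antisymm h.1 h0) h.2)
  have hdiff : ∀ w : ℂ, 0 ≤ w.re → w.re ≤ σ → w ≠ 0 →
      DifferentiableAt ℂ (fun w => w ^ p * kernel ε α w) w := fun w h0 h1 hw =>
    (differentiableAt_id.cpow_const (hslit w h0 hw)).mul (hB.differentiableAt_kernel α h0 h1 hw)
  -- The powers of `‖w‖` are together at most `exp (p.re * ‖w‖)`; half of the Gaussian absorbs the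
  -- growth in `|Im w|` and leaves `p.re ^ 2 / (2 * α)`.
  refine integral_line_eq_integral_line_zero (f := fun w => w ^ p * kernel ε α w) hσ.le
    (δ := α / 2) (A := c⁻¹ * Real.exp (Real.pi * |p.im|) *
      Real.exp (α * σ ^ 2 + p.re * σ + p.re ^ 2 / (2 * α))) (half_pos hα) ?_ ?_ ?_
  · rintro w ⟨h0, h1⟩
    by_cases hw : w = 0
    · subst hw
      -- Continuity at the origin is where `Re p > 2` is needed: the bound contains `‖w‖ ^ (p.re -
      -- 2)`, which tends to `0`.
      rw [ContinuousWithinAt, zero_cpow hp0, zero_mul]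
      have hcont : Continuous fun w : ℂ => ‖w‖ ^ (p.re - 2) *
          (c⁻¹ * Real.exp (Real.pi * |p.im|) * Real.exp (α * (w.re ^ 2 - w.im ^ 2)) *
            (1 + ‖w‖ ^ 2)) :=
        (continuous_norm.rpow_const fun _ => Or.inr (by linarith)).mul (by fun_prop)
      have hlim := hcont.tendsto 0
      rw [norm_zero, Real.zero_rpow (by linarith), zero_mul] at hlim
      refine squeeze_zero_norm' ?_ (hlim.mono_left nhdsWithin_le_nhds)
      filter_upwards [self_mem_nhdsWithin] with w hw
      by_cases hw0 : w = 0
      · simp [hw0, zero_cpow hp0, Real.zero_rpow (show p.re - 2 ≠ 0 by linarith)]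
      · exact hB.norm_cpow_mul_kernel_le hw.1 hw.2 hw0
    · exact (hdiff w h0 h1 hw).continuousAt.continuousWithinAt
  · intro w h0 h1
    exact hdiff w h0.le h1.le fun h => by simp [h] at h0
  · intro w h0 h1
    by_cases hw : w = 0
    · rw [hw, zero_cpow hp0, zero_mul, norm_zero]
      positivity
    refine (hB.norm_cpow_mul_kernel_le h0 h1 hw).trans ?_
    have hn : ‖w‖ ≤ σ + |w.im| := by
      have := norm_le_abs_re_add_abs_im w
      rw [abs_of_nonneg h0] at this
      linarith
    have h2 : ‖w‖ ^ (p.re - 2) ≤ Real.exp ((p.re - 2) * ‖w‖) := by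
      rw [mul_comm, Real.exp_mul]
      refine Real.rpow_le_rpow (norm_nonneg _) ?_ (by linarith)
      linarith [Real.add_one_le_exp ‖w‖]
    have h3 : 1 + ‖w‖ ^ 2 ≤ Real.exp (2 * ‖w‖) := by
      rw [two_mul, Real.exp_add]
      nlinarith [Real.add_one_le_exp ‖w‖, norm_nonneg w]
    have h4 := mul_abs_sub_sq_le hα p.re w.im
    have h5 : w.re ^ 2 ≤ σ ^ 2 := pow_le_pow_left₀ h0 h1 2
    calc _ ≤ Real.exp ((p.re - 2) * ‖w‖) * (c⁻¹ * Real.exp (Real.pi * |p.im|) *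
          Real.exp (α * (w.re ^ 2 - w.im ^ 2)) * Real.exp (2 * ‖w‖)) := by gcongr
      _ = c⁻¹ * Real.exp (Real.pi * |p.im|) *
          Real.exp ((p.re - 2) * ‖w‖ + α * (w.re ^ 2 - w.im ^ 2) + 2 * ‖w‖) := by
          rw [Real.exp_add, Real.exp_add]; ring
      _ ≤ c⁻¹ * Real.exp (Real.pi * |p.im|) *
          Real.exp (α * σ ^ 2 + p.re * σ + p.re ^ 2 / (2 * α) + -(α / 2) * w.im ^ 2) := by
          refine mul_le_mul_of_nonneg_left (Real.exp_le_exp.mpr ?_) (by positivity)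
          have h6 := mul_le_mul_of_nonneg_left hn (show 0 ≤ p.re by linarith)
          have h7 := mul_le_mul_of_nonneg_left h5 hα.le
          linarith
      _ = _ := by rw [Real.exp_add _ (-(α / 2) * w.im ^ 2)]; ring

end DenominatorBound

/-! ### Evaluation on the imaginary axis -/

lemma hasSum_of_forall_eq {f g : ℕ → ℂ} {z : ℂ} (hg : HasSum g z) (h : ∀ n, f n = g n) :
    HasSum f z := by
  rwa [funext h]

lemma ofReal_mul_cpow {r : ℝ} (hr : 0 < r) {x : ℂ} (hx : x ≠ 0) (p : ℂ) :
    ((r : ℂ) * x) ^ p = (r : ℂ) ^ p * x ^ p := by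
  have hr' : (r : ℂ) ≠ 0 := ofReal_ne_zero.mpr hr.ne'
  rw [cpow_def_of_ne_zero (mul_ne_zero hr' hx), cpow_def_of_ne_zero hr', cpow_def_of_ne_zero hx,
    log_ofReal_mul hr hx, ofReal_log hr.le, add_mul, exp_add]

/-- The principal arguments are `±π/2`, so the two powers are `-i exp(iπs)` and `i exp(-iπs)`. -/
lemma I_cpow_add_neg_I_cpow (s : ℂ) :
    I ^ (2 * s - 1) + (-I) ^ (2 * s - 1) = 2 * sin (Real.pi * s) := by
  have h1 : I ^ (2 * s - 1) = exp (Real.pi * s * I) * -I := by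
    rw [cpow_def_of_ne_zero I_ne_zero, log_I, ← exp_neg_pi_div_two_mul_I, ← exp_add]
    ring_nf
  have h2 : (-I) ^ (2 * s - 1) = exp (-(Real.pi * s) * I) * I := by
    rw [cpow_def_of_ne_zero (neg_ne_zero.mpr I_ne_zero), log_neg_I]
    nth_rw 3 [← exp_pi_div_two_mul_I]
    rw [← exp_add]
    ring_nf
  rw [h1, h2, sin]
  ring

lemma kernel_line_zero (ε : ℂ) (α t : ℝ) :
    kernel ε α (line 0 t) =
      exp (-α * (t ^ 2 : ℝ)) / (1 - ε * exp (-(t ^ 2 : ℝ))) := by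
  have : line 0 t ^ 2 = -(t ^ 2 : ℝ) := by
    rw [line]
    push_cast
    linear_combination (t : ℂ) ^ 2 * I_sq
  rw [kernel, this, mul_neg, neg_mul]

/-- Expanding `1 / (1 - ε e⁻ˣ)` geometrically gives terms `εⁿ exp(-(n + α)x)`, each with Mellin
transform `εⁿ Γ(s) (n + α)⁻ˢ`. Comparison with `∑ (n + α) ^ (-Re s)` justifies the interchange. -/
lemma mellin_kernel {ε : ℂ} (hε : ‖ε‖ ≤ 1) {α : ℝ} (hα : 0 < α) {s Z : ℂ} (hs : 1 < s.re)
    (hZ : HasSum (fun n : ℕ => ε ^ n / ((n + α : ℝ) : ℂ) ^ s) Z) :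
    mellin (fun x : ℝ => exp (-α * x) / (1 - ε * exp (-x))) s = Gamma s * Z := by
  have h := hasSum_mellin (a := fun n : ℕ => ε ^ n) (p := fun n : ℕ => n + α)
    (F := fun x : ℝ => exp (-α * x) / (1 - ε * exp (-x))) (s := s)
    (fun n => Or.inr (by positivity)) (by linarith) ?_ ?_
  · simp only [mul_div_assoc] at h
    exact h.unique (hZ.mul_left _)
  · intro t ht
    have hlt : ‖ε * exp (-t)‖ < 1 := by
      rw [norm_mul, ← ofReal_neg, norm_exp_ofReal]
      have h1 : Real.exp (-t) < 1 := Real.exp_lt_one_iff.mpr (neg_lt_zero.mpr ht)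
      nlinarith [norm_nonneg ε, Real.exp_pos (-t)]
    have h1 := (hasSum_geometric_of_norm_lt_one hlt).mul_left (exp (-α * t))
    rw [← div_eq_mul_inv] at h1
    refine hasSum_of_forall_eq h1 fun n => ?_
    rw [mul_pow, ← exp_nat_mul, mul_left_comm, ← exp_add]
    push_cast
    ring_nf
  · refine Summable.of_nonneg_of_le (fun n => by positivity) (fun n => ?_)
      ((Real.summable_one_div_nat_add_rpow α s.re).mpr hs)
    rw [abs_of_pos (by positivity)]
    gcongr
    rw [norm_pow]
    exact pow_le_one₀ (norm_nonneg _) hε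

/-- On the half-plane where the contour may be moved to the imaginary axis, the integral is
a Mellin transform. -/
theorem DenominatorBound.integral_eq_sin_mul_Gamma_mul {ε : ℂ} {σ c : ℝ}
    (hB : DenominatorBound ε σ c) (hσ : 0 < σ) (hε : ‖ε‖ ≤ 1) {α : ℝ} (hα : 0 < α) {s Z : ℂ}
    (hs : 3 / 2 < s.re)
    (hZ : HasSum (fun n : ℕ => ε ^ n / ((n + α : ℝ) : ℂ) ^ s) Z) :
    ∫ t, line σ t ^ (2 * s - 1) * kernel ε α (line σ t) =
      sin (Real.pi * s) * (Gamma s * Z) := by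
  obtain ⟨hint, heq⟩ := hB.integral_cpow_mul_kernel_eq hσ hα (p := 2 * s - 1)
    (by simp; linarith)
  rw [heq]
  set F : ℝ → ℂ := fun x => exp (-α * x) / (1 - ε * exp (-x)) with hF
  -- The substitution `x = t²` halves both the Mellin argument `2s` and the value.
  have hmel : ∫ t in Ioi (0 : ℝ), (t : ℂ) ^ (2 * s - 1) * F (t ^ 2) = (Gamma s * Z) / 2 := by
    have h1 := mellin_comp_rpow F (2 * s) 2
    rw [ofReal_ofNat, mul_div_cancel_left₀ s two_ne_zero,
      mellin_kernel hε hα (by linarith) hZ] at h1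
    simp only [mellin, smul_eq_mul, Real.rpow_two] at h1
    rw [h1, abs_two, real_smul]
    push_cast
    ring
  have hpos : ∫ t in Ioi (0 : ℝ), line 0 t ^ (2 * s - 1) * kernel ε α (line 0 t) =
      I ^ (2 * s - 1) * (Gamma s * Z / 2) := by
    rw [← hmel, ← integral_const_mul]
    refine setIntegral_congr_fun measurableSet_Ioi fun t ht => ?_
    have e : line 0 t = (t : ℂ) * I := by simp [line, mul_comm]
    simp only [kernel_line_zero, hF]
    rw [e, ofReal_mul_cpow ht I_ne_zero]
    ring
  have hneg : ∫ t in Iic (0 : ℝ), line 0 t ^ (2 * s - 1) * kernel ε α (line 0 t) =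
      (-I) ^ (2 * s - 1) * (Gamma s * Z / 2) := by
    rw [← hmel, ← integral_const_mul, ← neg_zero, ← integral_comp_neg_Ioi, neg_zero]
    refine setIntegral_congr_fun measurableSet_Ioi fun t ht => ?_
    have e : line 0 (-t) = (t : ℂ) * -I := by simp [line, mul_comm]
    simp only [kernel_line_zero, hF, neg_sq]
    rw [e, ofReal_mul_cpow ht (neg_ne_zero.mpr I_ne_zero)]
    ring
  rw [← intervalIntegral.integral_Iic_add_Ioi hint.integrableOn hint.integrableOn (b := 0), hpos,
    hneg]
  linear_combination (Gamma s * Z / 2) * I_cpow_add_neg_I_cpow s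

/-! ### Analytic continuation and the integral representations -/

lemma eq_of_eq_on_halfPlane {f g : ℂ → ℂ} {x : ℝ} (hf : ∀ s ≠ 1, DifferentiableAt ℂ f s)
    (hg : ∀ s ≠ 1, DifferentiableAt ℂ g s) (h : ∀ s : ℂ, x < s.re → f s = g s) {s : ℂ}
    (hs : s ≠ 1) : f s = g s := by
  have han : ∀ {f : ℂ → ℂ}, (∀ s ≠ 1, DifferentiableAt ℂ f s) → AnalyticOnNhd ℂ f {1}ᶜ :=
    fun hf => DifferentiableOn.analyticOnNhd
      (fun s hs => (hf s hs).differentiableWithinAt) isOpen_compl_singleton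
  have hx : x < ((max x 1 + 1 : ℝ) : ℂ).re := by
    rw [ofReal_re]
    linarith [le_max_left x 1]
  refine (han hf).eqOn_of_preconnected_of_eventuallyEq (han hg)
    (isConnected_compl_singleton_of_one_lt_rank (by simp) 1).isPreconnected
    (z₀ := ((max x 1 + 1 : ℝ) : ℂ)) ?_
    (eventuallyEq_of_mem ((isOpen_lt continuous_const continuous_re).mem_nhds hx) h) hs
  rw [mem_compl_singleton_iff, ← ofReal_one, Ne, ofReal_inj]
  linarith [le_max_right x 1]

lemma two_mul_sub_half (s : ℂ) : 2 * (s - 1 / 2) = 2 * s - 1 := by ring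

lemma integrandG_eq (σ : ℝ) (s : ℂ) : integrandG σ (s - 1 / 2) =
    fun t => line σ t ^ (2 * s - 1) * kernel 0 1 (line σ t) := by
  funext t
  rw [integrandG, kernel, two_mul_sub_half, ofReal_one, one_mul, zero_mul, sub_zero, div_one]

lemma integrandR_eq (σ : ℝ) (s : ℂ) (a : ℝ) : integrandR σ (s - 1 / 2) a =
    fun t => line σ t ^ (2 * s - 1) * kernel 1 a (line σ t) := by
  funext t
  rw [integrandR, kernel, two_mul_sub_half, one_mul]

lemma integrandD_eq (σ : ℝ) (s : ℂ) (a : ℝ) : integrandD σ (s - 1 / 2) a =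
    fun t => line σ t ^ (2 * s - 1) * kernel (-1) a (line σ t) := by
  funext t
  rw [integrandD, kernel, two_mul_sub_half, neg_one_mul, sub_neg_eq_add]

lemma DenominatorBound.differentiable_integral {ε : ℂ} {σ c : ℝ} (hB : DenominatorBound ε σ c)
    (hσ : 0 < σ) {α : ℝ} (hα : 0 < α) :
    Differentiable ℂ fun s : ℂ => ∫ t, line σ t ^ (2 * s - 1) * kernel ε α (line σ t) :=
  (hB.differentiable_integral_cpow_mul_kernel hσ hα).comp
    ((differentiable_id.const_mul 2).sub_const 1)

theorem integrable_integrandG {τ : ℝ} (hτ : 0 < τ) (s : ℂ) :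
    Integrable (integrandG τ (s - 1 / 2)) := by
  obtain ⟨c, hB⟩ := exists_denominatorBound_zero hτ.le
  rw [integrandG_eq]
  exact hB.integrable_cpow_mul_kernel hτ one_pos _

lemma differentiable_G {τ : ℝ} (hτ : 0 < τ) : Differentiable ℂ fun s => G τ (s - 1 / 2) := by
  obtain ⟨c, hB⟩ := exists_denominatorBound_zero hτ.le
  simp only [G, integrandG_eq]
  exact hB.differentiable_integral hτ one_pos

lemma G_eq_sin_mul_Gamma {τ : ℝ} (hτ : 0 < τ) {s : ℂ} (hs : 3 / 2 < s.re) :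
    G τ (s - 1 / 2) = sin (Real.pi * s) * Gamma s := by
  obtain ⟨c, hB⟩ := exists_denominatorBound_zero hτ.le
  -- Since `0 ^ 0 = 1`, only the term `n = 0` survives, and it equals `1`.
  have hZ : HasSum (fun n : ℕ => (0 : ℂ) ^ n / ((n + 1 : ℝ) : ℂ) ^ s) 1 := by
    convert hasSum_single (f := fun n : ℕ => (0 : ℂ) ^ n / ((n + 1 : ℝ) : ℂ) ^ s) 0
      fun n hn => by simp [hn]
    simp
  simp only [G, integrandG_eq]
  rw [hB.integral_eq_sin_mul_Gamma_mul hτ (by simp) one_pos hs hZ, mul_one]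

/-- Hankel's formula for the reciprocal of the Gamma function. -/
theorem G_eq_pi_div_Gamma {τ : ℝ} (hτ : 0 < τ) {s : ℂ} (hs : s ≠ 1) :
    G τ (s - 1 / 2) = Real.pi * (Gamma (1 - s))⁻¹ := by
  refine eq_of_eq_on_halfPlane (x := 3 / 2) (f := fun s => G τ (s - 1 / 2))
    (g := fun s => Real.pi * (Gamma (1 - s))⁻¹) (fun s _ => differentiable_G hτ s)
    (fun s _ => (((differentiable_one_div_Gamma (1 - s)).comp s
      ((differentiableAt_const 1).sub differentiableAt_id)).const_mul _)) (fun s hs => ?_) hs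
  rw [G_eq_sin_mul_Gamma hτ hs]
  have hpi : (Real.pi : ℂ) ≠ 0 := ofReal_ne_zero.mpr Real.pi_ne_zero
  have hG : Gamma s ≠ 0 := Gamma_ne_zero_of_re_pos (by linarith)
  have hrefl := Gamma_mul_Gamma_one_sub s
  -- At integers the reflection formula reads `Γ(s) Γ(1 - s) = 0` by the convention `π / 0 = 0`; so
  -- `Γ(1 - s)` takes the value `0` and both sides vanish.
  by_cases h0 : sin (Real.pi * s) = 0
  · rw [h0, div_zero, mul_eq_zero] at hrefl
    rw [h0, hrefl.resolve_left hG]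
    simp
  · have h1 : Gamma (1 - s) ≠ 0 := fun h => by
      rw [h, mul_zero, eq_comm, div_eq_zero_iff] at hrefl
      exact hrefl.elim hpi h0
    field_simp
    rw [eq_div_iff h0] at hrefl
    linear_combination hrefl

theorem G_ne_zero {τ : ℝ} (hτ : 0 < τ) {s : ℂ} (hs : ∀ n : ℕ, 1 ≤ n → s ≠ n) :
    G τ (s - 1 / 2) ≠ 0 := by
  rw [G_eq_pi_div_Gamma hτ (by simpa using hs 1 le_rfl)]
  refine mul_ne_zero (ofReal_ne_zero.mpr Real.pi_ne_zero) (inv_ne_zero (Gamma_ne_zero fun m h => ?_))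
  refine hs (m + 1) (by omega) ?_
  push_cast
  linear_combination -h

/-- For `Re s > 3/2` both sides equal `sin(πs) Γ(s) Z(s)`, whatever `σ` and `τ` are; the identity
theorem does the rest. -/
lemma DenominatorBound.integral_eq_G_mul {ε : ℂ} {σ c : ℝ} (hB : DenominatorBound ε σ c)
    (hσ : 0 < σ) (hε : ‖ε‖ ≤ 1) {a : ℝ} (ha : 0 < a) {Z : ℂ → ℂ}
    (hZd : ∀ s ≠ 1, DifferentiableAt ℂ Z s)
    (hZ : ∀ s : ℂ, 1 < s.re → HasSum (fun n : ℕ => ε ^ n / ((n + a : ℝ) : ℂ) ^ s) (Z s))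
    {τ : ℝ} (hτ : 0 < τ) {s : ℂ} (hs : s ≠ 1) :
    ∫ t, line σ t ^ (2 * s - 1) * kernel ε a (line σ t) = G τ (s - 1 / 2) * Z s :=
  eq_of_eq_on_halfPlane (x := 3 / 2)
    (f := fun s => ∫ t, line σ t ^ (2 * s - 1) * kernel ε a (line σ t))
    (g := fun s => G τ (s - 1 / 2) * Z s)
    (fun s _ => hB.differentiable_integral hσ ha s)
    (fun s hs => (differentiable_G hτ s).mul (hZd s hs))
    (fun s hs => by
      rw [hB.integral_eq_sin_mul_Gamma_mul hσ hε ha hs (hZ s (by linarith)),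
        G_eq_sin_mul_Gamma hτ hs, mul_assoc]) hs

section Representation

variable {σ τ a : ℝ} {s : ℂ}

theorem integrable_integrandR (hσ : 0 < σ) (hσ' : σ < √Real.pi) (ha : 0 < a) (s : ℂ) :
    Integrable (integrandR σ (s - 1 / 2) a) := by
  obtain ⟨c, hB⟩ := exists_denominatorBound_one hσ.le hσ'
  rw [integrandR_eq]
  exact hB.integrable_cpow_mul_kernel hσ ha _

theorem R_eq_G_mul_zeta (hσ : 0 < σ) (hσ' : σ < √Real.pi) (ha : 0 < a) (hτ : 0 < τ)
    (hs : s ≠ 1) : R σ (s - 1 / 2) a = G τ (s - 1 / 2) * zeta s a := by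
  obtain ⟨c, hB⟩ := exists_denominatorBound_one hσ.le hσ'
  simp only [R, integrandR_eq]
  exact hB.integral_eq_G_mul hσ (by simp) ha (Z := fun s => zeta s a)
    (fun s hs => differentiableAt_zeta a hs)
    (fun s hs => by simpa only [one_pow] using hasSum_zeta ha hs) hτ hs

theorem integrable_integrandD (hσ : 0 < σ) (hσ' : σ < √(Real.pi / 2)) (ha : 0 < a) (s : ℂ) :
    Integrable (integrandD σ (s - 1 / 2) a) := by
  obtain ⟨c, hB⟩ := exists_denominatorBound_neg_one hσ.le hσ'
  rw [integrandD_eq]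
  exact hB.integrable_cpow_mul_kernel hσ ha _

theorem D_eq_G_mul_eta (hσ : 0 < σ) (hσ' : σ < √(Real.pi / 2)) (ha : 0 < a) (hτ : 0 < τ)
    (hs : s ≠ 1) : D σ (s - 1 / 2) a = G τ (s - 1 / 2) * eta s a := by
  obtain ⟨c, hB⟩ := exists_denominatorBound_neg_one hσ.le hσ'
  simp only [D, integrandD_eq]
  exact hB.integral_eq_G_mul hσ (by simp) ha (Z := fun s => eta s a)
    (fun s _ => differentiable_eta a s) (fun s hs => hasSum_eta ha hs) hτ hs

end Representation

/-! ### Zeros in the strip and the Riemann hypothesis -/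

lemma zeta_one (s : ℂ) : zeta s 1 = riemannZeta s := by
  have : ((1 : ℝ) : UnitAddCircle) = 0 := AddCircle.coe_period 1
  simp [zeta, this, HurwitzZeta.hurwitzZeta_zero]

/-- The duplication formula `ζ(s, 1/2) + ζ(s) = 2 ^ s ζ(s)`. -/
theorem zeta_half_add_zeta_one {s : ℂ} (hs : s ≠ 1) :
    zeta s (1 / 2) + zeta s 1 = 2 ^ s * zeta s 1 := by
  have h2 : ∀ s : ℂ, DifferentiableAt ℂ (fun s : ℂ => (2 : ℂ) ^ s) s := fun s =>
    differentiableAt_id.const_cpow (Or.inl two_ne_zero)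
  refine eq_of_eq_on_halfPlane (x := 1) (f := fun s => zeta s (1 / 2) + zeta s 1)
    (g := fun s => 2 ^ s * zeta s 1)
    (fun s hs => (differentiableAt_zeta _ hs).add (differentiableAt_zeta _ hs))
    (fun s hs => (h2 s).mul (differentiableAt_zeta _ hs)) (fun s hs => ?_) hs
  have key : ∀ x : ℝ, 0 < x → (2 : ℂ) ^ s / ((2 * x : ℝ) : ℂ) ^ s = 1 / (x : ℂ) ^ s := by
    intro x hx
    have h := mul_cpow_ofReal_nonneg zero_le_two hx.le s
    rw [ofReal_ofNat] at h
    have h0 : (2 : ℂ) ^ s ≠ 0 := by simp [cpow_eq_zero_iff]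
    rw [ofReal_mul, ofReal_ofNat, h, div_mul_eq_div_div, div_self h0]
  have h := (hasSum_zeta one_pos hs).mul_left ((2 : ℂ) ^ s)
  -- With bases `n + 1`, even indices give `2m + 1 = 2(m + 1/2)` and odd ones `2m + 2 = 2(m + 1)`.
  refine HasSum.unique (HasSum.even_add_odd ?_ ?_) h
  · refine hasSum_of_forall_eq (hasSum_zeta (a := 1 / 2) (by norm_num) hs) fun n => ?_
    rw [← key (n + 1 / 2) (by positivity), mul_one_div]
    congr 3
    push_cast
    ring
  · refine hasSum_of_forall_eq (hasSum_zeta one_pos hs) fun n => ?_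
    rw [← key (n + 1) (by positivity), mul_one_div]
    congr 3
    push_cast
    ring

theorem eta_one {s : ℂ} (hs : s ≠ 1) : 2 ^ s * eta s 1 = (2 ^ s - 2) * riemannZeta s := by
  have h0 : (2 : ℂ) ^ s ≠ 0 := by simp [cpow_eq_zero_iff]
  have h := zeta_half_add_zeta_one hs
  rw [eta, mul_div_cancel₀ _ h0, one_add_one_eq_two, div_self two_ne_zero, ← zeta_one]
  linear_combination h

/-- The factor `2 ^ s - 2` relating `η` to `ζ` cannot vanish, since `|2 ^ s| = 2 ^ (Re s) < 2`. -/
lemma eta_one_eq_zero_iff {s : ℂ} (hs : s.re < 1) : eta s 1 = 0 ↔ riemannZeta s = 0 := by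
  have h0 : (2 : ℂ) ^ s ≠ 0 := by simp [cpow_eq_zero_iff]
  have h1 : (2 : ℂ) ^ s - 2 ≠ 0 := fun h => by
    have h2 := congrArg norm (sub_eq_zero.mp h)
    rw [← ofReal_ofNat, norm_cpow_eq_rpow_re_of_pos two_pos, norm_real, Real.norm_eq_abs,
      abs_two] at h2
    have h3 := Real.rpow_lt_rpow_of_exponent_lt one_lt_two hs
    rw [Real.rpow_one] at h3
    linarith
  have h := eta_one (s := s) fun h => by simp [h] at hs
  rw [← or_iff_right (b := eta s 1 = 0) h0, ← mul_eq_zero, h, mul_eq_zero, or_iff_right h1]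

/-- In the closed left half-plane the zeta function has only its trivial zeros. -/
theorem riemannZeta_eq_zero_of_re_nonpos {s : ℂ} (hs : s.re ≤ 0) (h : riemannZeta s = 0) :
    ∃ n : ℕ, s = -2 * (n + 1) := by
  have hs0 : s ≠ 0 := by
    rintro rfl
    norm_num [riemannZeta_zero] at h
  have hre : 1 ≤ (1 - s).re := by simpa using hs
  have hfe := riemannZeta_one_sub (s := 1 - s)
    (fun n hn => by
      rw [hn] at hre
      simp at hre
      have : (0 : ℝ) ≤ n := n.cast_nonneg
      linarith)
    (fun h1 => hs0 (by linear_combination -h1))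
  rw [sub_sub_cancel, h] at hfe
  -- In the functional equation at `1 - s`, every factor but the cosine is nonzero, because `Re (1 -
  -- s) ≥ 1`.
  have hcos : cos (Real.pi * (1 - s) / 2) = 0 := by
    have h1 := riemannZeta_ne_zero_of_one_le_re hre
    have h2 : Gamma (1 - s) ≠ 0 := Gamma_ne_zero_of_re_pos (by linarith)
    have h3 : (2 * Real.pi : ℂ) ^ (-(1 - s)) ≠ 0 := by
      simp [cpow_eq_zero_iff, Real.pi_ne_zero]
    simpa [h1, h2, h3] using hfe.symm
  obtain ⟨k, hk⟩ := cos_eq_zero_iff.mp hcos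
  have hpi : (Real.pi : ℂ) ≠ 0 := ofReal_ne_zero.mpr Real.pi_ne_zero
  have hsk : s = -2 * k := by
    have : (Real.pi : ℂ) * (1 - s) = Real.pi * (2 * k + 1) := by linear_combination 2 * hk
    have := mul_left_cancel₀ hpi this
    linear_combination -this
  -- The case `k = 0` would be `s = 0`, where `ζ` does not vanish.
  have hk0 : 0 < k := by
    have h1 : (0 : ℝ) ≤ k := by
      rw [hsk] at hs
      simpa using hs
    refine lt_of_le_of_ne (by exact_mod_cast h1) fun h2 => hs0 ?_
    rw [hsk, ← h2]
    simp
  refine ⟨(k - 1).toNat, ?_⟩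
  have h2 : (((k - 1).toNat : ℤ) : ℂ) = k - 1 := by
    rw [Int.toNat_of_nonneg (by omega)]
    push_cast
    ring
  rw [Int.cast_natCast] at h2
  rw [h2, hsk]
  ring

/-- Zeros outside the open strip do not matter: there are none with `Re s ≥ 1`, and those with `Re s
≤ 0` are trivial. -/
theorem riemannHypothesis_iff :
    RiemannHypothesis ↔ ∀ z : ℂ, |z.re| < 1 / 2 → riemannZeta (z + 1 / 2) = 0 → z.re = 0 := by
  constructor
  · intro hRH z hz h0
    rw [abs_lt] at hz
    have hre : (z + 1 / 2).re = z.re + 1 / 2 := by simp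
    have := hRH (z + 1 / 2) h0 ?_ ?_
    · linarith
    · rintro ⟨n, hn⟩
      rw [hn] at hre
      simp at hre
      have : (0 : ℝ) ≤ n := n.cast_nonneg
      linarith
    · intro h
      rw [h, one_re] at hre
      linarith
  · intro h s hs htriv hs1
    have h1 : s.re < 1 := by
      by_contra! h1
      exact riemannZeta_ne_zero_of_one_le_re h1 hs
    have h0 : 0 < s.re := by
      by_contra! h0
      exact htriv (riemannZeta_eq_zero_of_re_nonpos h0 hs)
    have hre : (s - 1 / 2).re = s.re - 1 / 2 := by simp
    have := h (s - 1 / 2) (by rw [hre, abs_lt]; constructor <;> linarith)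
      (by rwa [sub_add_cancel])
    linarith

/-- A function whose zeros in the strip `|Re z| < 1/2` are those of `ζ(z + 1/2)` can replace the
zeta function in the Riemann hypothesis. -/
lemma riemannHypothesis_iff_of_eq_zero_iff {F : ℂ → ℂ}
    (h : ∀ z : ℂ, |z.re| < 1 / 2 → (F z = 0 ↔ riemannZeta (z + 1 / 2) = 0)) :
    RiemannHypothesis ↔ ∀ z : ℂ, |z.re| < 1 / 2 → F z = 0 → z.re = 0 := by
  rw [riemannHypothesis_iff]
  exact forall₂_congr fun z hz => by rw [h z hz]

lemma re_add_half_lt_one {z : ℂ} (hz : |z.re| < 1 / 2) : (z + 1 / 2).re < 1 := by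
  have := (abs_lt.mp hz).2
  have hre : (z + 1 / 2).re = z.re + 1 / 2 := by simp
  linarith

lemma G_ne_zero_of_re_lt {τ : ℝ} (hτ : 0 < τ) {s : ℂ} (hs : s.re < 1) : G τ (s - 1 / 2) ≠ 0 :=
  G_ne_zero hτ fun n hn h => by
    rw [h, natCast_re] at hs
    exact hs.not_ge (by exact_mod_cast hn)

lemma R_one_eq_zero_iff {σ : ℝ} (hσ : 0 < σ) (hσ' : σ < √Real.pi) {z : ℂ}
    (hz : |z.re| < 1 / 2) : R σ z 1 = 0 ↔ riemannZeta (z + 1 / 2) = 0 := by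
  have hs := re_add_half_lt_one hz
  -- The line for `G` is arbitrary; `τ = 1` is chosen, next to `a = 1`.
  have h := R_eq_G_mul_zeta hσ hσ' one_pos one_pos (s := z + 1 / 2) fun h => by
    rw [h, one_re] at hs
    exact hs.false
  have hG := G_ne_zero_of_re_lt one_pos hs
  rw [add_sub_cancel_right] at h hG
  rw [h, zeta_one, mul_eq_zero, or_iff_right hG]

lemma D_one_eq_zero_iff {σ : ℝ} (hσ : 0 < σ) (hσ' : σ < √(Real.pi / 2)) {z : ℂ}
    (hz : |z.re| < 1 / 2) : D σ z 1 = 0 ↔ riemannZeta (z + 1 / 2) = 0 := by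
  have hs := re_add_half_lt_one hz
  have h := D_eq_G_mul_eta hσ hσ' one_pos one_pos (s := z + 1 / 2) fun h => by
    rw [h, one_re] at hs
    exact hs.false
  have hG := G_ne_zero_of_re_lt one_pos hs
  rw [add_sub_cancel_right] at h hG
  rw [h, mul_eq_zero, or_iff_right hG, eta_one_eq_zero_iff hs]

end ParabolicZeta

theorem theorem3 :
    -- integral representations of the Hurwitz and the alternating zeta function
    (∀ (a : ℝ) (s : ℂ), 0 < a → (∀ n : ℕ, 1 ≤ n → s ≠ (n : ℂ)) →
      ∀ τ : ℝ, 0 < τ →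
        (Integrable (ParabolicZeta.integrandG τ (s - 1 / 2)) ∧
          ParabolicZeta.G τ (s - 1 / 2) ≠ 0) ∧
        (∀ σ : ℝ, 0 < σ → σ < √Real.pi →
          Integrable (ParabolicZeta.integrandR σ (s - 1 / 2) a) ∧
          ParabolicZeta.zeta s a =
            ParabolicZeta.R σ (s - 1 / 2) a / ParabolicZeta.G τ (s - 1 / 2)) ∧
        (∀ σ : ℝ, 0 < σ → σ < √(Real.pi / 2) →
          Integrable (ParabolicZeta.integrandD σ (s - 1 / 2) a) ∧
          ParabolicZeta.eta s a =
            ParabolicZeta.D σ (s - 1 / 2) a / ParabolicZeta.G τ (s - 1 / 2))) ∧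
    -- the Riemann hypothesis in terms of the zeros of `R(z) = R(z, 1)`
    (∀ σ : ℝ, 0 < σ → σ < √Real.pi →
      (RiemannHypothesis ↔
        ∀ z : ℂ, |z.re| < 1 / 2 → ParabolicZeta.R σ z 1 = 0 → z.re = 0)) ∧
    -- the Riemann hypothesis in terms of the zeros of `D(z) = D(z, 1)`
    (∀ σ : ℝ, 0 < σ → σ < √(Real.pi / 2) →
      (RiemannHypothesis ↔
        ∀ z : ℂ, |z.re| < 1 / 2 → ParabolicZeta.D σ z 1 = 0 → z.re = 0)) := by
  refine ⟨fun a s ha hs τ hτ => ?_, fun σ hσ hσ' => ?_, fun σ hσ hσ' => ?_⟩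
  · have hs1 : s ≠ 1 := by simpa using hs 1 le_rfl
    have hG := ParabolicZeta.G_ne_zero hτ hs
    refine ⟨⟨ParabolicZeta.integrable_integrandG hτ s, hG⟩, fun σ hσ hσ' => ⟨?_, ?_⟩,
      fun σ hσ hσ' => ⟨?_, ?_⟩⟩
    · exact ParabolicZeta.integrable_integrandR hσ hσ' ha s
    · rw [ParabolicZeta.R_eq_G_mul_zeta hσ hσ' ha hτ hs1, mul_div_cancel_left₀ _ hG]
    · exact ParabolicZeta.integrable_integrandD hσ hσ' ha s
    · rw [ParabolicZeta.D_eq_G_mul_eta hσ hσ' ha hτ hs1, mul_div_cancel_left₀ _ hG]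
  · exact ParabolicZeta.riemannHypothesis_iff_of_eq_zero_iff fun z hz =>
      ParabolicZeta.R_one_eq_zero_iff hσ hσ' hz
  · exact ParabolicZeta.riemannHypothesis_iff_of_eq_zero_iff fun z hz =>
      ParabolicZeta.D_one_eq_zero_iff hσ hσ' hz
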